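/- Let $\mathcal{A}_k=(Q,\Sigma,\delta,Q_0,F)$ be a nondeterministic Büchi automaton with finite state set $Q$, finite alphabet $\Sigma$, transitions $\delta(q,a)\subseteq Q$, initial states $Q_0$ and final states $F$. A final path over $w=w_0w_1\ldots\in\Sigma^\omega$ is a sequence $q_0q_1\ldots\in Q^\omega$ with $q_0\in Q_0$ and $q_{i+1}\in\delta(q_i,w_i)$ for all $i$ in which some state of $F$ occurs infinitely often; the language of $\mathcal{A}_k$ is the set of words that have a final path. Assume that $\mathcal{A}_k$ is $k$-ambiguous, i.e. every $w\in\Sigma^\omega$ has at most $k$ final paths. *Image-binary Büchi automata.* Let $\mathcal{B}=(S,\Sigma,M,\alpha,G)$ consist of a finite set $S$ of states, matrices $M(a)\in\mathbb{Q}^{S\times S}$ for $a\in\Sigma$, a vector $\alpha\in\mathbb{Q}^S$ and $G\subseteq S$. There is an edge from $s$ to $s'$ if $M(a)_{s,s'}\neq 0$ for some $a$. A final path over $w$ is a sequence $s_0s_1\ldots\in S^\omega$ with $\alpha_{s_0}\ne0$ and $M(w_i)_{s_i,s_{i+1}}\neq0$ for all $i$ in which some state of $G$ occurs infinitely often; its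 weight is $\lim_{n\to\infty}\alpha_{s_0}\prod_{i<n}M(w_i)_{s_i,s_{i+1}}$. The weight $L_{\mathcal{B}}(w)$ of a word $w$ with finitely many final paths is the sum of the weights of its final paths. $\mathcal{B}$ is an image-binary Büchi automaton (IBA) if every edge on a loop has weight $1$ (whenever there is a possibly empty path from $s'$ to $s$, one has $M(a)_{s,s'}\in\{0,1\}$ for all $a$), the number of final paths over $w$ is bounded by a constant independent of $w$, and $L_{\mathcal{B}}(w)$ is defined and lies in $\{0,1\}$ for all $w\in\Sigma^\omega$. It accepts the language $\{w\mid L_{\mathcal{B}}(w)=1\}$. *Successor counts.* Let $\mathbb{B}=\{\bot,\top\}$, let $[k]=\{0,\ldots,k\}$, and let $Q'$ be the set of nonempty sets $P$ of at most $k$ pairs $(r,b)$ with $r$ a nonempty finite word over $Q$ and $b\in\mathbb{B}$; call $P$ proper if no word occurs in $P$ with both bits. Let $\pi(P)\in[k]^{Q\times\mathbb{B}}$ be the vector $\pi(P)_{q,b}=|\{(r,b)\in P\mid \mathrm{last}(r)=q\}|$. For $P\in Q'$ let $b''=\bot$ if all bits in $P$ are $\top$, and $b''=\top$ otherwise. A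 pair $(r',b')$ is an $a$-extension of $(r,b)\in P$ if $r'=r\cdot q$ with $q\in\delta(\mathrm{last}(r),a)$ and $b'=((\mathrm{last}(r)\in F)\vee b)\wedge b''$. A set $P'\in Q'$ is an $a$-successor of $P$ if every element of $P$ has an $a$-extension in $P'$ and every element of $P'$ is an $a$-extension of an element of $P$. For $\vec r,\vec r'\in[k]^{Q\times\mathbb{B}}$ let $w(\vec r,a,\vec r')$ be the number of $a$-successors $P'$ with $\pi(P')=\vec r'$ of any proper $P\in Q'$ with $\pi(P)=\vec r$ (and $0$ if there is no such $P$). *The $k$-disambiguation.* For $\vec r\in[k]^{Q\times\mathbb{B}}$ let $\mathrm{size}(\vec r)=\sum_{q,b}\vec r_{q,b}$. Let $\mathrm{kdis}'(\mathcal{A}_k)$ have the state set $[k]^{Q\times\mathbb{B}}\setminus\{\vec0\}$, the weights $M(a)_{\vec r,\vec r'}=(-1)^{\mathrm{size}(\vec r')-\mathrm{size}(\vec r)}\,w(\vec r,a,\vec r')$, the initial vector $\alpha_{\vec r}=(-1)^{\mathrm{size}(\vec r)-1}$ if $\vec r_{q,b}=0$ whenever $q\notin Q_0$ or $b=\top$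 and $\vec r_{q,b}\le1$ otherwise, and $\alpha_{\vec r}=0$ for all other $\vec r$, and the final states $\{\vec r\mid \vec r_{q,\bot}=0\text{ for all }q\in Q\}$. The $k$-disambiguation $\mathrm{kdis}(\mathcal{A}_k)$ is the restriction of $\mathrm{kdis}'(\mathcal{A}_k)$ to those states that are reachable from a state $\vec r$ with $\alpha_{\vec r}\ne0$ and can reach a loop through a final state. **Theorem.** The number $w(\vec r,a,\vec r')$ is well defined, i.e. it does not depend on the choice of the proper set $P$ with $\pi(P)=\vec r$, and $\mathrm{kdis}(\mathcal{A}_k)$ is an IBA that accepts the same language as $\mathcal{A}_k$. -/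

import Mathlib

open Filter Topology

/-- `q` occurs infinitely often in `ρ` for some `q` in `F` (the Büchi acceptance condition). -/
def BuchiAccepting {Q : Type*} (F : Set Q) (ρ : ℕ → Q) : Prop :=
  ∃ q ∈ F, ∃ᶠ n in atTop, ρ n = q

/-- A nondeterministic Büchi automaton with state set `Q` over the alphabet `A`. -/
structure NBA (Q A : Type*) where
  /-- the transition relation: `δ q a` is the set of `a`-successors of `q` -/
  δ : Q → A → Set Q
  /-- the initial states -/
  init : Set Q
  /-- the final states -/
  final : Set Q

namespace NBA

variable {Q A : Type*}

def IsPath (𝒜 : NBA Q A) (w : ℕ → A) (ρ : ℕ → Q) : Prop :=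
  ρ 0 ∈ 𝒜.init ∧ ∀ i, ρ (i + 1) ∈ 𝒜.δ (ρ i) (w i)

def finalPaths (𝒜 : NBA Q A) (w : ℕ → A) : Set (ℕ → Q) :=
  {ρ | 𝒜.IsPath w ρ ∧ BuchiAccepting 𝒜.final ρ}

def language (𝒜 : NBA Q A) : Set (ℕ → A) :=
  {w | (𝒜.finalPaths w).Nonempty}

/-- Every infinite word has at most `k` final paths. -/
def IsAmbiguous (𝒜 : NBA Q A) (k : ℕ) : Prop :=
  ∀ w, (𝒜.finalPaths w).encard ≤ k

end NBA

/-- A `ℚ`-weighted automaton with a set of (Büchi) final states. -/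
structure WeightedBuchi (Q A : Type*) where
  /-- the transition matrices -/
  M : A → Matrix Q Q ℚ
  /-- the initial vector -/
  init : Q → ℚ
  /-- the final states -/
  final : Set Q

namespace WeightedBuchi

variable {Q A : Type*}

def Edge (ℬ : WeightedBuchi Q A) (p q : Q) : Prop :=
  ∃ a, ℬ.M a p q ≠ 0

/-- Every edge `q → q'` that lies on a loop, i.e. such that there is a (possibly empty) path from
`q'` back to `q`, has weight `1`. -/
def UltimatelyStable (ℬ : WeightedBuchi Q A) : Prop :=
  ∀ q q' a, Relation.ReflTransGen ℬ.Edge q' q → ℬ.M a q q' = 0 ∨ ℬ.M a q q' = 1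

def IsPath (ℬ : WeightedBuchi Q A) (w : ℕ → A) (ρ : ℕ → Q) : Prop :=
  ℬ.init (ρ 0) ≠ 0 ∧ ∀ i, ℬ.M (w i) (ρ i) (ρ (i + 1)) ≠ 0

def finalPaths (ℬ : WeightedBuchi Q A) (w : ℕ → A) : Set (ℕ → Q) :=
  {ρ | ℬ.IsPath w ρ ∧ BuchiAccepting ℬ.final ρ}

/-- `c` is the weight of `ρ` over `w`: the limit of the weights of the finite prefixes of `ρ`,
where the weight of a prefix is its initial weight times the product of its edge weights. -/
def HasPathWeight (ℬ : WeightedBuchi Q A) (w : ℕ → A) (ρ : ℕ → Q) (c : ℚ) : Prop :=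
  Tendsto (fun n => ℬ.init (ρ 0) * ∏ i ∈ Finset.range n, ℬ.M (w i) (ρ i) (ρ (i + 1)))
    atTop (𝓝 c)

/-- `v` is the weight of `w`: there are finitely many final paths over `w`, each of them has
a weight, and `v` is the sum of these weights. -/
def HasWordWeight (ℬ : WeightedBuchi Q A) (w : ℕ → A) (v : ℚ) : Prop :=
  ∃ (h : (ℬ.finalPaths w).Finite) (c : (ℕ → Q) → ℚ),
    (∀ ρ ∈ ℬ.finalPaths w, ℬ.HasPathWeight w ρ (c ρ)) ∧ v = ∑ ρ ∈ h.toFinset, c ρ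

/-- Image-binary (weighted) Büchi automata. -/
structure IsImageBinary (ℬ : WeightedBuchi Q A) : Prop where
  finite_states : Finite Q
  stable : ℬ.UltimatelyStable
  bounded : ∃ N : ℕ, ∀ w, (ℬ.finalPaths w).encard ≤ N
  binary : ∀ w, ℬ.HasWordWeight w 0 ∨ ℬ.HasWordWeight w 1

/-- The language of an image-binary Büchi automaton: the words of weight `1`. -/
def language (ℬ : WeightedBuchi Q A) : Set (ℕ → A) :=
  {w | ℬ.HasWordWeight w 1}

/-- `q` is reachable from an initial state and can reach a loop through a final state. -/
def IsTrimState (ℬ : WeightedBuchi Q A) (q : Q) : Prop :=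
  (∃ s, ℬ.init s ≠ 0 ∧ Relation.ReflTransGen ℬ.Edge s q) ∧
    ∃ f ∈ ℬ.final, Relation.ReflTransGen ℬ.Edge q f ∧ Relation.TransGen ℬ.Edge f f

/-- The restriction of `ℬ` to its trim states. -/
def trim (ℬ : WeightedBuchi Q A) : WeightedBuchi {q // ℬ.IsTrimState q} A where
  M a := (ℬ.M a).submatrix Subtype.val Subtype.val
  init q := ℬ.init q
  final := {q | q.1 ∈ ℬ.final}

end WeightedBuchi

/-- A nonempty set of at most `k` pairs `(r, b)`, where `r` is a nonempty finite word over `Q`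
and `b` is a bit. The nonempty word `u · q` with last letter `q` is represented as `(u, q)`. -/
structure PrefixSet (Q : Type*) (k : ℕ) where
  carrier : Finset ((List Q × Q) × Bool)
  nonempty : carrier.Nonempty
  card_le : carrier.card ≤ k

namespace PrefixSet

variable {Q : Type*} {k : ℕ}

/-- No word occurs in `P` with both bits. -/
def Proper (P : PrefixSet Q k) : Prop :=
  ∀ x ∈ P.carrier, ∀ y ∈ P.carrier, x.1 = y.1 → x = y

open Classical in
/-- The count vector of `P`: its `(q, b)` entry is the number of `(r, b) ∈ P` such that `r` ends
in `q`. -/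
noncomputable def countVec (P : PrefixSet Q k) : Q × Bool → Fin (k + 1) := fun p =>
  ⟨{x ∈ P.carrier | x.1.2 = p.1 ∧ x.2 = p.2}.card,
    Nat.lt_succ_of_le ((Finset.card_le_card (Finset.filter_subset _ _)).trans P.card_le)⟩

end PrefixSet

namespace NBA

variable {Q A : Type*} {k : ℕ}

open Classical in
/-- The bit that the successors of `(r, b) ∈ P` carry, where `q` is the last letter of `r`:
`(q ∈ F ∨ b) ∧ b''`, where `b''` is false if all bits in `P` are true, and true otherwise. -/
noncomputable def nextBit (𝒜 : NBA Q A) (P : PrefixSet Q k) (q : Q) (b : Bool) : Bool :=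
  decide ((q ∈ 𝒜.final ∨ b = true) ∧ ¬ ∀ x ∈ P.carrier, x.2 = true)

/-- `y` extends the element `x` of `P` by one `a`-transition. -/
def Extends (𝒜 : NBA Q A) (a : A) (P : PrefixSet Q k) (x y : (List Q × Q) × Bool) : Prop :=
  ∃ q ∈ 𝒜.δ x.1.2 a, y = ((x.1.1 ++ [x.1.2], q), 𝒜.nextBit P x.1.2 x.2)

/-- `P'` is an `a`-successor of `P`. -/
def IsSucc (𝒜 : NBA Q A) (a : A) (P P' : PrefixSet Q k) : Prop :=
  (∀ x ∈ P.carrier, ∃ y ∈ P'.carrier, 𝒜.Extends a P x y) ∧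
    ∀ y ∈ P'.carrier, ∃ x ∈ P.carrier, 𝒜.Extends a P x y

/-- The number of `a`-successors of `P` whose count vector is `r'`. -/
noncomputable def succCount (𝒜 : NBA Q A) (P : PrefixSet Q k) (a : A)
    (r' : Q × Bool → Fin (k + 1)) : ℕ :=
  {P' : PrefixSet Q k | 𝒜.IsSucc a P P' ∧ P'.countVec = r'}.ncard

open Classical in
/-- `w(r, a, r')`: the number of `a`-successors with count vector `r'` of any one proper `P` with
count vector `r`; it is `0` if there is no such `P` (that is, if the entries of `r` sum to `0` or
to more than `k`). -/
noncomputable def succNum (𝒜 : NBA Q A) (r : Q × Bool → Fin (k + 1)) (a : A)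
    (r' : Q × Bool → Fin (k + 1)) : ℕ :=
  if h : ∃ P : PrefixSet Q k, P.Proper ∧ P.countVec = r then 𝒜.succCount h.choose a r' else 0

/-- The nonzero count vectors in `{0, …, k}^(Q × Bool)`. -/
abbrev CountVec (Q : Type*) (k : ℕ) := {r : Q × Bool → Fin (k + 1) // r ≠ 0}

def CountVec.size [Fintype Q] (r : CountVec Q k) : ℕ := ∑ p, (r.1 p : ℕ)

open Classical in
/-- The automaton on all nonzero count vectors, before trimming. -/
noncomputable def preKdis [Fintype Q] (𝒜 : NBA Q A) (k : ℕ) : WeightedBuchi (CountVec Q k) A where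
  M a := Matrix.of fun r r' =>
    (-1 : ℚ) ^ ((CountVec.size r' : ℤ) - CountVec.size r) * 𝒜.succNum r.1 a r'.1
  init r :=
    if ∀ q b, if q ∉ 𝒜.init ∨ b = true then r.1 (q, b) = 0 else (r.1 (q, b) : ℕ) ≤ 1 then
      (-1 : ℚ) ^ ((CountVec.size r : ℤ) - 1)
    else 0
  final := {r | ∀ q, r.1 (q, false) = 0}

/-- The states of the `k`-disambiguation. -/
abbrev KdisState [Fintype Q] (𝒜 : NBA Q A) (k : ℕ) :=
  {r : CountVec Q k // (𝒜.preKdis k).IsTrimState r}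

/-- The `k`-disambiguation of `𝒜`. -/
noncomputable def kdis [Fintype Q] (𝒜 : NBA Q A) (k : ℕ) :
    WeightedBuchi (𝒜.KdisState k) A :=
  (𝒜.preKdis k).trim

end NBA

/-! ### Words, labels and relabelling of prefix sets. -/

namespace PrefixSet

variable {Q : Type*} {k : ℕ}

/-! The proof is inclusion-exclusion over sets of final paths. By `k`-ambiguity every nonempty set
`R` of final paths over `w` has at most `k` elements, and the sum of `(-1)^(|R|-1)` over these `R`
is `1` if there is a final path and `0` otherwise (`sum_finalSeqSets_sign`).

Such an `R` is followed through its prefixes: `trace R n` is a prefix set, each trace is a successor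
of the one before, and the bits implement a breakpoint construction. All bits are true infinitely
often iff every path of `R` meets the final states infinitely often (`frequently_traceBit_iff`).
Conversely, every infinite chain of successors from an initial set is a trace (`exists_eq_trace`).

The automaton sees only count vectors. This suffices because the number of successors depends on the
count vector alone (`succNum_countVec`). For a path `r` of count vectors, the weight of a prefix is
a sign times the number of prefix sets in `reachSets w r n` (`preKdis_prefix_weight`). If `r` is
final, these sets are the traces of the `R` with count sequence `r` (`reachSets_eq_image`). For
large `n` prefixes separate the final paths, so the weight becomes constant, equal to the sum of the
signs of these `R` (`hasPathWeight_preKdis`). Summing over `r` counts each `R` once.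

Stability is a pumping argument: the number of reached prefix sets along a final path is at most `2
^ k`, so a loop edge of a trim state cannot have successor count `2` or more
(`succNum_le_one_of_loop`). Trimming keeps all final paths. -/

theorem carrier_injective : Function.Injective (carrier : PrefixSet Q k → _) := by
  rintro ⟨c, _, _⟩ ⟨c', _, _⟩ h
  simp only at h
  subst h
  rfl

/-- The pair of the last letter and the bit. -/
def label (x : (List Q × Q) × Bool) : Q × Bool := (x.1.2, x.2)

/-- The underlying nonempty word as a list. -/
def word (x : (List Q × Q) × Bool) : List Q := x.1.1 ++ [x.1.2]

theorem word_eq_iff {x y : (List Q × Q) × Bool} : word x = word y ↔ x.1 = y.1 := by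
  constructor
  · intro h
    have := List.append_inj' h rfl
    exact Prod.ext this.1 (by simpa using this.2)
  · intro h
    simp [word, h]

theorem Proper.injOn_word {P : PrefixSet Q k} (hP : P.Proper) :
    Set.InjOn word (P.carrier : Set ((List Q × Q) × Bool)) := fun x hx y hy h =>
  hP x hx y hy (word_eq_iff.1 h)

open Classical in
theorem countVec_apply (P : PrefixSet Q k) (p : Q × Bool) :
    (P.countVec p : ℕ) = {x ∈ P.carrier | label x = p}.card := by
  simp [countVec, label, Prod.ext_iff]

open Classical in
/-- The image of a prefix set under a function. -/
noncomputable def map (g : (List Q × Q) × Bool → (List Q × Q) × Bool) (P : PrefixSet Q k) :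
    PrefixSet Q k :=
  ⟨P.carrier.image g, P.nonempty.image g, Finset.card_image_le.trans P.card_le⟩

theorem mem_carrier_map {g : (List Q × Q) × Bool → (List Q × Q) × Bool} {P : PrefixSet Q k}
    {y : (List Q × Q) × Bool} : y ∈ (P.map g).carrier ↔ ∃ x ∈ P.carrier, g x = y := by
  classical
  simp [map]

theorem countVec_map {g : (List Q × Q) × Bool → (List Q × Q) × Bool} {P : PrefixSet Q k}
    (hg : Set.InjOn g (P.carrier : Set ((List Q × Q) × Bool)))
    (hl : ∀ x, label (g x) = label x) : (P.map g).countVec = P.countVec := by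
  classical
  ext p
  rw [countVec_apply, countVec_apply]
  simp only [map, Finset.filter_image, hl]
  exact Finset.card_image_of_injOn (hg.mono fun x hx => (Finset.mem_filter.1 hx).1)

theorem exists_bijOn_of_countVec_eq {P P' : PrefixSet Q k} (h : P.countVec = P'.countVec) :
    ∃ e : (List Q × Q) × Bool → (List Q × Q) × Bool,
      Set.BijOn e (P.carrier : Set ((List Q × Q) × Bool)) P'.carrier ∧
        ∀ x ∈ P.carrier, label (e x) = label x := by
  classical
  have hf : ∀ p : Q × Bool, ∃ f : (List Q × Q) × Bool → (List Q × Q) × Bool,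
      Set.BijOn f ({x ∈ P.carrier | label x = p} : Finset _)
        ({x ∈ P'.carrier | label x = p} : Finset _) := by
    intro p
    have hc : ({x ∈ P.carrier | label x = p} : Finset _).card
        = ({x ∈ P'.carrier | label x = p} : Finset _).card := by
      rw [← countVec_apply, ← countVec_apply, h]
    obtain ⟨x₀, _⟩ := P.nonempty
    have : Nonempty ((List Q × Q) × Bool) := ⟨x₀⟩
    exact (Finset.finite_toSet _).exists_bijOn_of_encard_eq (by
      rw [Set.encard_coe_eq_coe_finsetCard, Set.encard_coe_eq_coe_finsetCard, hc])
  choose f hf using hf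
  have hmaps : ∀ x ∈ P.carrier, f (label x) x ∈ P'.carrier ∧ label (f (label x) x) = label x :=
    fun x hx => Finset.mem_filter.1 ((hf (label x)).mapsTo (x := x) (by simpa using hx))
  refine ⟨fun x => f (label x) x, ⟨fun x hx => (hmaps x hx).1, fun x hx y hy hxy => ?_, ?_⟩,
    fun x hx => (hmaps x hx).2⟩
  · have hl : label x = label y := by
      rw [← (hmaps x hx).2, ← (hmaps y hy).2]
      exact congrArg label hxy
    simp only [hl] at hxy
    exact (hf (label y)).injOn (by simpa [hl] using hx) (by simpa using hy) hxy
  · intro y hy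
    obtain ⟨x, hx, hxy⟩ := (hf (label y)).surjOn (a := y) (by simpa using hy)
    rw [Finset.mem_coe, Finset.mem_filter] at hx
    exact ⟨x, hx.1, by simpa [hx.2] using hxy⟩

end PrefixSet

/-! ### Successor counts are well defined. -/

namespace NBA

open PrefixSet

variable {Q A : Type*} {k : ℕ} {𝒜 : NBA Q A} {a : A} {P P' P₁ P₂ : PrefixSet Q k}

theorem extends_iff {x y : (List Q × Q) × Bool} :
    𝒜.Extends a P x y ↔
      y.1.1 = word x ∧ y.1.2 ∈ 𝒜.δ x.1.2 a ∧ y.2 = 𝒜.nextBit P x.1.2 x.2 := by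
  constructor
  · rintro ⟨q, hq, rfl⟩
    exact ⟨rfl, hq, rfl⟩
  · rintro ⟨h, hq, hb⟩
    exact ⟨y.1.2, hq, Prod.ext (Prod.ext h rfl) hb⟩

theorem IsSucc.proper (h : 𝒜.IsSucc a P P') (hP : P.Proper) : P'.Proper := by
  intro y hy y' hy' hyy
  obtain ⟨x, hx, hxy⟩ := h.2 y hy
  obtain ⟨x', hx', hxy'⟩ := h.2 y' hy'
  rw [extends_iff] at hxy hxy'
  have : x = x' := hP.injOn_word hx hx' (by rw [← hxy.1, ← hxy'.1, hyy])
  subst this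
  exact Prod.ext hyy (hxy.2.2.trans hxy'.2.2.symm)

/-- Prefix sets may form an infinite type; this finiteness keeps `ncard` from taking its default
value `0`. -/
theorem finite_setOf_isSucc [Finite Q] (𝒜 : NBA Q A) (a : A) (P : PrefixSet Q k) :
    {P' : PrefixSet Q k | 𝒜.IsSucc a P P'}.Finite := by
  classical
  have := Fintype.ofFinite Q
  refine Set.Finite.of_injOn (f := PrefixSet.carrier) (t := ((P.carrier ×ˢ Finset.univ).image
    fun z : ((List Q × Q) × Bool) × Q =>
      ((word z.1, z.2), 𝒜.nextBit P z.1.1.2 z.1.2)).powerset) ?_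
    carrier_injective.injOn (Finset.finite_toSet _)
  intro P' hP'
  simp only [Finset.coe_powerset, Set.mem_preimage, Set.mem_powerset_iff, Finset.coe_subset]
  intro y hy
  obtain ⟨x, hx, q, hq, rfl⟩ := hP'.2 y hy
  simp only [Finset.mem_image, Finset.mem_product, Finset.mem_univ, and_true]
  exact ⟨(x, q), hx, rfl⟩

/-- Equal count vectors give a label-preserving bijection `e`. Successors depend on a word only
through its last letter and bit, so replacing the parent word of each extension along `e` injects
one family of successors into the other. By symmetry an inequality is enough. -/
theorem succCount_le_of_countVec_eq [Finite Q] (h₁ : P₁.Proper) (h₂ : P₂.Proper)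
    (h : P₁.countVec = P₂.countVec) (a : A) (r' : Q × Bool → Fin (k + 1)) :
    𝒜.succCount P₁ a r' ≤ 𝒜.succCount P₂ a r' := by
  obtain ⟨e, he, hl⟩ := exists_bijOn_of_countVec_eq h
  obtain ⟨x₀, _⟩ := P₁.nonempty
  have : Nonempty ((List Q × Q) × Bool) := ⟨x₀⟩
  -- `σ` transports parent words along `e`; properness of `P₁` lets a word recover its pair.
  let σ : List Q → List Q := fun u => word (e (Function.invFunOn word P₁.carrier u))
  have hσ : ∀ x ∈ P₁.carrier, σ (word x) = word (e x) := fun x hx => by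
    simp only [σ]
    rw [h₁.injOn_word.leftInvOn_invFunOn hx]
  let g : (List Q × Q) × Bool → (List Q × Q) × Bool := fun y => ((σ y.1.1, y.1.2), y.2)
  have hlast : ∀ x ∈ P₁.carrier, (e x).1.2 = x.1.2 := fun x hx =>
    congrArg (Prod.fst : Q × Bool → Q) (hl x hx)
  have hbit : ∀ x ∈ P₁.carrier, (e x).2 = x.2 := fun x hx =>
    congrArg (Prod.snd : Q × Bool → Bool) (hl x hx)
  have hall : (∀ x ∈ P₁.carrier, x.2 = true) ↔ ∀ x ∈ P₂.carrier, x.2 = true := by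
    constructor
    · intro H y hy
      obtain ⟨x, hx, rfl⟩ := he.surjOn hy
      exact (hbit x hx).trans (H x hx)
    · intro H x hx
      exact (hbit x hx).symm.trans (H _ (he.mapsTo hx))
  have hnext : ∀ q b, 𝒜.nextBit P₁ q b = 𝒜.nextBit P₂ q b := fun q b => by
    rw [nextBit, nextBit, decide_eq_decide, hall]
  have hext : ∀ x ∈ P₁.carrier, ∀ y, 𝒜.Extends a P₁ x y → 𝒜.Extends a P₂ (e x) (g y) := by
    intro x hx y hxy
    rw [extends_iff] at hxy ⊢
    refine ⟨?_, ?_, ?_⟩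
    · simp only [g, hxy.1, hσ x hx]
    · simpa only [g, hlast x hx] using hxy.2.1
    · simpa only [g, hlast x hx, hbit x hx, hnext] using hxy.2.2
  have hg : Set.InjOn g {y | ∃ x ∈ P₁.carrier, 𝒜.Extends a P₁ x y} := by
    rintro y ⟨x, hx, hxy⟩ y' ⟨x', hx', hxy'⟩ hgy
    rw [extends_iff] at hxy hxy'
    simp only [g, Prod.mk.injEq, hxy.1, hxy'.1, hσ x hx, hσ x' hx'] at hgy
    have hxx : x = x' :=
      he.injOn hx hx' (h₂.injOn_word (he.mapsTo hx) (he.mapsTo hx') hgy.1.1)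
    exact Prod.ext (Prod.ext (by rw [hxy.1, hxy'.1, hxx]) hgy.1.2) hgy.2
  have hsub : ∀ {P'}, 𝒜.IsSucc a P₁ P' →
      (P'.carrier : Set _) ⊆ {y | ∃ x ∈ P₁.carrier, 𝒜.Extends a P₁ x y} :=
    fun hP' y hy => hP'.2 y hy
  refine Set.ncard_le_ncard_of_injOn (PrefixSet.map g) ?_ ?_
    ((finite_setOf_isSucc 𝒜 a P₂).subset fun _ h => h.1)
  · rintro P' ⟨hP', hc⟩
    refine ⟨⟨fun x hx => ?_, fun y hy => ?_⟩, ?_⟩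
    · obtain ⟨x, hx', rfl⟩ := he.surjOn hx
      obtain ⟨y, hy, hxy⟩ := hP'.1 x hx'
      exact ⟨g y, PrefixSet.mem_carrier_map.2 ⟨y, hy, rfl⟩, hext x hx' y hxy⟩
    · obtain ⟨y, hy', rfl⟩ := PrefixSet.mem_carrier_map.1 hy
      obtain ⟨x, hx, hxy⟩ := hP'.2 y hy'
      exact ⟨e x, he.mapsTo hx, hext x hx y hxy⟩
    · rw [countVec_map (hg.mono (hsub hP')) fun _ => rfl, hc]
  · rintro P' ⟨hP', -⟩ P'' ⟨hP'', -⟩ heq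
    apply carrier_injective
    rw [← Finset.coe_inj, ← hg.image_eq_image_iff (hsub hP') (hsub hP'')]
    ext y
    have := congrArg (fun P : PrefixSet Q k => y ∈ P.carrier) heq
    simpa only [PrefixSet.mem_carrier_map, eq_iff_iff, Set.mem_image, Finset.mem_coe] using this

theorem succNum_countVec [Finite Q] (hP : P.Proper) (a : A) (r' : Q × Bool → Fin (k + 1)) :
    𝒜.succNum P.countVec a r' = 𝒜.succCount P a r' := by
  have h : ∃ P' : PrefixSet Q k, P'.Proper ∧ P'.countVec = P.countVec := ⟨P, hP, rfl⟩
  rw [succNum, dif_pos h]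
  exact le_antisymm (succCount_le_of_countVec_eq h.choose_spec.1 hP h.choose_spec.2 a r')
    (succCount_le_of_countVec_eq hP h.choose_spec.1 h.choose_spec.2.symm a r')

theorem exists_proper_of_succNum_ne_zero {r r' : Q × Bool → Fin (k + 1)}
    (h : 𝒜.succNum r a r' ≠ 0) : ∃ P : PrefixSet Q k, P.Proper ∧ P.countVec = r := by
  by_contra hn
  exact h (by rw [succNum, dif_neg hn])

theorem exists_isSucc_of_succNum_ne_zero [Finite Q] (hP : P.Proper)
    {r' : Q × Bool → Fin (k + 1)} (h : 𝒜.succNum P.countVec a r' ≠ 0) :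
    ∃ P' : PrefixSet Q k, 𝒜.IsSucc a P P' ∧ P'.countVec = r' := by
  rw [succNum_countVec hP] at h
  exact Set.nonempty_of_ncard_ne_zero h

theorem IsSucc.succNum_ne_zero [Finite Q] (h : 𝒜.IsSucc a P P') (hP : P.Proper) :
    𝒜.succNum P.countVec a P'.countVec ≠ 0 := by
  rw [succNum_countVec hP]
  exact Set.ncard_ne_zero_of_mem (a := P') ⟨h, rfl⟩
    ((finite_setOf_isSucc 𝒜 a P).subset fun _ h => h.1)

/-- Extensions of different words differ, so sizes never drop along an edge. On a loop they are
therefore constant and the sign of the weight is `1`. -/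
theorem IsSucc.card_le (h : 𝒜.IsSucc a P P') (hP : P.Proper) :
    P.carrier.card ≤ P'.carrier.card := by
  choose! f hf hext using h.1
  refine Finset.card_le_card_of_injOn f hf fun x hx y hy hxy => hP.injOn_word hx hy ?_
  rw [← (extends_iff.1 (hext x hx)).1, ← (extends_iff.1 (hext y hy)).1, hxy]

end NBA

/-! ### Count vectors of prefix sets as states. -/

namespace PrefixSet

variable {Q : Type*} {k : ℕ}

theorem countVec_label_ne_zero {P : PrefixSet Q k} {x : (List Q × Q) × Bool}
    (hx : x ∈ P.carrier) : P.countVec (label x) ≠ 0 := by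
  classical
  intro h
  have h' := congrArg Fin.val h
  rw [countVec_apply, Fin.val_zero, Finset.card_eq_zero] at h'
  exact Finset.notMem_empty x (h' ▸ Finset.mem_filter.2 ⟨hx, rfl⟩)

theorem exists_mem_of_countVec_ne_zero {P : PrefixSet Q k} {p : Q × Bool}
    (hp : P.countVec p ≠ 0) : ∃ x ∈ P.carrier, label x = p := by
  classical
  by_contra! h
  refine hp (Fin.ext ?_)
  rw [countVec_apply, Fin.val_zero, Finset.card_eq_zero]
  exact Finset.filter_eq_empty_iff.2 fun x hx => h x hx

/-- The count vector of a prefix set as a state of the disambiguation. -/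
noncomputable def toCount (P : PrefixSet Q k) : NBA.CountVec Q k :=
  ⟨P.countVec, fun h => by
    obtain ⟨x, hx⟩ := P.nonempty
    exact countVec_label_ne_zero hx (congrFun h _)⟩

theorem size_toCount [Fintype Q] (P : PrefixSet Q k) :
    NBA.CountVec.size P.toCount = P.carrier.card := by
  classical
  simp only [NBA.CountVec.size, toCount, countVec_apply]
  exact (Finset.card_eq_sum_card_fiberwise (f := label) (t := Finset.univ)
    fun x _ => Finset.mem_coe.2 (Finset.mem_univ _)).symm

theorem toCount_final_iff [Fintype Q] {A : Type*} (𝒜 : NBA Q A) (P : PrefixSet Q k) :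
    P.toCount ∈ (𝒜.preKdis k).final ↔ ∀ x ∈ P.carrier, x.2 = true := by
  constructor
  · intro h x hx
    by_contra hb
    rw [Bool.not_eq_true] at hb
    refine countVec_label_ne_zero hx ?_
    rw [label, hb]
    exact h x.1.2
  · intro h q
    by_contra hq
    obtain ⟨x, hx, hl⟩ := exists_mem_of_countVec_ne_zero hq
    have : x.2 = false := congrArg (Prod.snd : Q × Bool → Bool) hl
    simp [h x hx] at this

/-- The set of words of a prefix set. -/
def words (P : PrefixSet Q k) : Set (List Q × Q) := {u | ∃ x ∈ P.carrier, x.1 = u}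

end PrefixSet

/-! ### Prefix sets reached along a sequence of count vectors. -/

namespace NBA

open PrefixSet

variable {Q A : Type*} {k : ℕ} {𝒜 : NBA Q A} {a : A} {P P' P₁ P₂ P₁' P₂' : PrefixSet Q k}

/-- All words of `P` are initial states, with bit `false`. -/
def IsInitSet (𝒜 : NBA Q A) (P : PrefixSet Q k) : Prop :=
  ∀ x ∈ P.carrier, x.1.1 = [] ∧ x.1.2 ∈ 𝒜.init ∧ x.2 = false

theorem IsInitSet.proper (h : 𝒜.IsInitSet P) : P.Proper := fun x hx y hy hxy =>
  Prod.ext hxy ((h x hx).2.2.trans (h y hy).2.2.symm)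

theorem IsInitSet.carrier_subset (h₁ : 𝒜.IsInitSet P₁) (h₂ : 𝒜.IsInitSet P₂)
    (h : P₁.words ⊆ P₂.words) : P₁.carrier ⊆ P₂.carrier := by
  intro x hx
  obtain ⟨y, hy, hxy⟩ := h ⟨x, hx, rfl⟩
  rwa [← (Prod.ext hxy ((h₂ y hy).2.2.trans (h₁ x hx).2.2.symm) : y = x)]

/-- Deleting the last letter of a successor's words recovers the parent's words. -/
theorem IsSucc.words_subset (h₁ : 𝒜.IsSucc a P₁ P₁') (h₂ : 𝒜.IsSucc a P₂ P₂')
    (h : P₁'.words ⊆ P₂'.words) : P₁.words ⊆ P₂.words := by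
  rintro _ ⟨x, hx, rfl⟩
  obtain ⟨y, hy, hxy⟩ := h₁.1 x hx
  obtain ⟨y', hy', hyy⟩ := h ⟨y, hy, rfl⟩
  obtain ⟨x', hx', hxy'⟩ := h₂.2 y' hy'
  rw [extends_iff] at hxy hxy'
  exact ⟨x', hx', word_eq_iff.1 (by rw [← hxy.1, ← hxy'.1, hyy])⟩

/-- In a proper set a word determines its parent and hence its bit, so the words of a successor fix
it completely. -/
theorem IsSucc.carrier_subset (hP : P.Proper) (h₁ : 𝒜.IsSucc a P P₁')
    (h₂ : 𝒜.IsSucc a P P₂') (h : P₁'.words ⊆ P₂'.words) : P₁'.carrier ⊆ P₂'.carrier := by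
  intro y hy
  obtain ⟨y', hy', hyy⟩ := h ⟨y, hy, rfl⟩
  obtain ⟨x, hx, hxy⟩ := h₁.2 y hy
  obtain ⟨x', hx', hxy'⟩ := h₂.2 y' hy'
  rw [extends_iff] at hxy hxy'
  have hxx : x = x' := hP.injOn_word hx hx' (by rw [← hxy.1, ← hxy'.1, hyy])
  subst hxx
  rwa [← (Prod.ext hyy (hxy'.2.2.trans hxy.2.2.symm) : y' = y)]

open Classical in
theorem preKdis_init_of_ne_zero [Fintype Q] {r : CountVec Q k}
    (h : (𝒜.preKdis k).init r ≠ 0) :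
    (𝒜.preKdis k).init r = (-1) ^ ((CountVec.size r : ℤ) - 1) ∧
      ∀ q b, if q ∉ 𝒜.init ∨ b = true then r.1 (q, b) = 0 else (r.1 (q, b) : ℕ) ≤ 1 := by
  simp only [preKdis, ne_eq, ite_eq_right_iff, not_forall] at h ⊢
  obtain ⟨h, -⟩ := h
  exact ⟨if_pos h, h⟩

theorem IsInitSet.preKdis_init_ne_zero [Fintype Q] (h : 𝒜.IsInitSet P) :
    (𝒜.preKdis k).init P.toCount ≠ 0 := by
  classical
  simp only [preKdis]
  rw [if_pos]
  · exact zpow_ne_zero _ (by norm_num)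
  · intro q b
    split_ifs with hqb
    · by_contra hne
      obtain ⟨x, hx, hl⟩ := exists_mem_of_countVec_ne_zero hne
      obtain ⟨rfl, rfl⟩ := Prod.mk.inj hl
      rcases hqb with hq | hb
      · exact hq (h x hx).2.1
      · simp [(h x hx).2.2] at hb
    · rw [toCount, countVec_apply, Finset.card_le_one]
      intro x hx y hy
      rw [Finset.mem_filter] at hx hy
      obtain ⟨h₁, h₂⟩ := Prod.mk.inj (hx.2.trans hy.2.symm)
      exact Prod.ext (Prod.ext ((h x hx.1).1.trans (h y hy.1).1.symm) h₁) h₂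

/-- A nonzero initial weight forces a 0/1 vector on initial states with bit false, so one-letter
words leave no choice. The set `P` is needed because such a vector could have more than `k` ones. -/
theorem exists_setOf_isInitSet_eq_singleton [Fintype Q] {r : CountVec Q k}
    (h : (𝒜.preKdis k).init r ≠ 0) (hP : P.countVec = r.1) :
    ∃ P₀ : PrefixSet Q k, {P | 𝒜.IsInitSet P ∧ P.toCount = r} = {P₀} := by
  classical
  have hr := (preKdis_init_of_ne_zero h).2
  rw [← hP] at hr
  have hmem : ∀ x ∈ P.carrier, x.1.2 ∈ 𝒜.init ∧ x.2 = false := by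
    intro x hx
    by_contra hn
    have := hr x.1.2 x.2
    rw [if_pos (by rwa [not_and_or, Bool.not_eq_false] at hn)] at this
    exact countVec_label_ne_zero hx this
  have hinj : Set.InjOn (fun x : (List Q × Q) × Bool => ((([] : List Q), x.1.2), x.2))
      (P.carrier : Set _) := by
    intro x hx y hy hxy
    simp only [Prod.mk.injEq, true_and] at hxy
    have := hr x.1.2 x.2
    rw [if_neg (by simpa using hmem x hx), countVec_apply, Finset.card_le_one] at this
    exact this x (Finset.mem_filter.2 ⟨hx, rfl⟩) y
      (Finset.mem_filter.2 ⟨hy, (Prod.ext hxy.1 hxy.2 : label x = label y).symm⟩)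
  refine ⟨P.map fun x => (([], x.1.2), x.2), Set.eq_singleton_iff_unique_mem.2 ⟨⟨?_, ?_⟩, ?_⟩⟩
  · intro y hy
    obtain ⟨x, hx, rfl⟩ := PrefixSet.mem_carrier_map.1 hy
    exact ⟨rfl, hmem x hx⟩
  · exact Subtype.ext ((countVec_map hinj fun _ => rfl).trans hP)
  · rintro P' ⟨hP', hc⟩
    have hcv : P'.countVec = P.countVec := (congrArg Subtype.val hc).trans hP.symm
    apply carrier_injective
    ext y
    rw [PrefixSet.mem_carrier_map]
    constructor
    · intro hy
      have := countVec_label_ne_zero hy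
      rw [hcv] at this
      obtain ⟨x, hx, hl⟩ := exists_mem_of_countVec_ne_zero this
      obtain ⟨h₁, h₂⟩ := Prod.mk.inj hl
      exact ⟨x, hx, Prod.ext (Prod.ext (hP' y hy).1.symm h₁) h₂⟩
    · rintro ⟨x, hx, rfl⟩
      have := countVec_label_ne_zero hx
      rw [← hcv] at this
      obtain ⟨y, hy, hl⟩ := exists_mem_of_countVec_ne_zero this
      obtain ⟨h₁, h₂⟩ := Prod.mk.inj hl
      rwa [← (Prod.ext (Prod.ext (hP' y hy).1 h₁) h₂ : y = (([], x.1.2), x.2))]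

/-- The prefix sets that can be reached over `w` in `n` steps along the count vectors `r`. -/
def reachSets (𝒜 : NBA Q A) (w : ℕ → A) (r : ℕ → CountVec Q k) : ℕ → Set (PrefixSet Q k)
  | 0 => {P | 𝒜.IsInitSet P ∧ P.toCount = r 0}
  | n + 1 => {P' | ∃ P ∈ reachSets 𝒜 w r n, 𝒜.IsSucc (w n) P P' ∧ P'.toCount = r (n + 1)}

variable {w : ℕ → A} {r : ℕ → CountVec Q k} {n : ℕ}

theorem toCount_of_mem_reachSets : ∀ {n}, P ∈ 𝒜.reachSets w r n → P.toCount = r n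
  | 0, h => h.2
  | _ + 1, ⟨_, _, _, h⟩ => h

theorem proper_of_mem_reachSets : ∀ {n} {P}, P ∈ 𝒜.reachSets w r n → P.Proper
  | 0, _, h => h.1.proper
  | _ + 1, _, ⟨_, h, hs, _⟩ => hs.proper (proper_of_mem_reachSets h)

theorem eq_of_mem_reachSets_of_words_eq (h₁ : P₁ ∈ 𝒜.reachSets w r n)
    (h₂ : P₂ ∈ 𝒜.reachSets w r n) (h : P₁.words = P₂.words) : P₁ = P₂ := by
  induction n generalizing P₁ P₂ with
  | zero =>
    exact carrier_injective ((h₁.1.carrier_subset h₂.1 h.subset).antisymm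
      (h₂.1.carrier_subset h₁.1 h.superset))
  | succ n ih =>
    obtain ⟨P, hP, hs, -⟩ := h₁
    obtain ⟨P', hP', hs', -⟩ := h₂
    obtain rfl := ih hP hP' ((hs.words_subset hs' h.subset).antisymm
      (hs'.words_subset hs h.superset))
    have hp := proper_of_mem_reachSets hP
    exact carrier_injective ((hs.carrier_subset hp hs' h.subset).antisymm
      (hs'.carrier_subset hp hs h.superset))

theorem reachSets_succ (n : ℕ) : 𝒜.reachSets w r (n + 1) =
    ⋃ P ∈ 𝒜.reachSets w r n, {P' | 𝒜.IsSucc (w n) P P' ∧ P'.countVec = (r (n + 1)).1} := by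
  ext P'
  simp [reachSets, Subtype.ext_iff, toCount, and_left_comm]

theorem finite_reachSets [Fintype Q] (hr : (𝒜.preKdis k).init (r 0) ≠ 0)
    (hP : P.countVec = (r 0).1) : ∀ n, (𝒜.reachSets w r n).Finite
  | 0 => by
    obtain ⟨P₀, h⟩ := exists_setOf_isInitSet_eq_singleton hr hP
    rw [reachSets, h]
    exact Set.finite_singleton _
  | n + 1 => by
    rw [reachSets_succ]
    exact (finite_reachSets hr hP n).biUnion fun P _ =>
      (finite_setOf_isSucc 𝒜 (w n) P).subset fun _ h => h.1

theorem ncard_reachSets_succ [Fintype Q] (hfin : (𝒜.reachSets w r n).Finite) :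
    (𝒜.reachSets w r (n + 1)).ncard =
      (𝒜.reachSets w r n).ncard * 𝒜.succNum (r n).1 (w n) (r (n + 1)).1 := by
  classical
  have hS : ∀ P : PrefixSet Q k,
      {P' | 𝒜.IsSucc (w n) P P' ∧ P'.countVec = (r (n + 1)).1}.Finite := fun P =>
    (finite_setOf_isSucc 𝒜 (w n) P).subset fun _ h => h.1
  have heq : 𝒜.reachSets w r (n + 1) =
      (hfin.toFinset.biUnion fun P => (hS P).toFinset : Finset (PrefixSet Q k)) := by
    rw [reachSets_succ]
    ext P'
    simp
  rw [heq, Set.ncard_coe_finset, Finset.card_biUnion, Set.ncard_eq_toFinset_card _ hfin]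
  · refine Finset.sum_const_nat fun P hP => ?_
    rw [Set.Finite.mem_toFinset] at hP
    rw [← toCount_of_mem_reachSets hP, toCount, succNum_countVec (proper_of_mem_reachSets hP),
      succCount, Set.ncard_eq_toFinset_card _ (hS P)]
  -- A common successor would give both sets the same words, and within `reachSets` these determine
  -- the set.
  · intro P₁ h₁ P₂ h₂ hne
    rw [Function.onFun, Finset.disjoint_left]
    intro P' h₁' h₂'
    rw [SetLike.mem_coe, Set.Finite.mem_toFinset] at h₁ h₂
    rw [Set.Finite.mem_toFinset] at h₁' h₂'
    exact hne (eq_of_mem_reachSets_of_words_eq h₁ h₂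
      ((h₁'.1.words_subset h₂'.1 subset_rfl).antisymm (h₂'.1.words_subset h₁'.1 subset_rfl)))

/-- The exponents of the signs telescope, while the successor counts multiply to the number of
reached sets. -/
theorem preKdis_prefix_weight [Fintype Q] (hr : (𝒜.preKdis k).init (r 0) ≠ 0)
    (hP : P.countVec = (r 0).1) (n : ℕ) :
    (𝒜.preKdis k).init (r 0) *
        ∏ i ∈ Finset.range n, (𝒜.preKdis k).M (w i) (r i) (r (i + 1)) =
      (-1) ^ ((CountVec.size (r n) : ℤ) - 1) * (𝒜.reachSets w r n).ncard := by
  induction n with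
  | zero =>
    obtain ⟨P₀, h⟩ := exists_setOf_isInitSet_eq_singleton hr hP
    rw [reachSets, h, (preKdis_init_of_ne_zero hr).1]
    simp
  | succ n ih =>
    rw [Finset.prod_range_succ, ← mul_assoc, ih, ncard_reachSets_succ (finite_reachSets hr hP n)]
    have hsum : ((CountVec.size (r (n + 1)) : ℤ) - 1) =
      ((CountVec.size (r n) : ℤ) - 1) + ((CountVec.size (r (n + 1)) : ℤ) - CountVec.size (r n)) :=
      by ring
    rw [hsum, zpow_add₀ (by norm_num)]
    simp only [preKdis, Matrix.of_apply]
    push_cast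
    ring

theorem preKdis_M_ne_zero_iff [Fintype Q] {r r' : CountVec Q k} :
    (𝒜.preKdis k).M a r r' ≠ 0 ↔ 𝒜.succNum r.1 a r'.1 ≠ 0 := by
  simp [preKdis, zpow_ne_zero]

theorem size_le_of_succNum_ne_zero [Fintype Q] {r r' : CountVec Q k}
    (h : 𝒜.succNum r.1 a r'.1 ≠ 0) : CountVec.size r ≤ CountVec.size r' := by
  obtain ⟨P, hP, hr⟩ := exists_proper_of_succNum_ne_zero h
  rw [← hr] at h
  obtain ⟨P', hs, hr'⟩ := exists_isSucc_of_succNum_ne_zero hP h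
  obtain rfl : P.toCount = r := Subtype.ext hr
  obtain rfl : P'.toCount = r' := Subtype.ext hr'
  rw [size_toCount, size_toCount]
  exact hs.card_le hP

end NBA

/-- Pigeonhole: with finitely many states, infinitely many visits to `F` repeat a single state
infinitely often. -/
theorem buchiAccepting_iff_frequently {Q : Type*} [Finite Q] {F : Set Q} {ρ : ℕ → Q} :
    BuchiAccepting F ρ ↔ ∃ᶠ n in atTop, ρ n ∈ F := by
  constructor
  · rintro ⟨q, hq, h⟩
    exact h.mono fun n hn => hn ▸ hq
  · intro h
    by_contra hn
    simp only [BuchiAccepting, not_exists, not_and, not_frequently] at hn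
    have h' : ∀ᶠ n in atTop, ∀ q, q ∈ F → ρ n ≠ q := by
      rw [eventually_all]
      intro q
      by_cases hq : q ∈ F
      · simpa [hq] using hn q hq
      · simp [hq]
    obtain ⟨n, hn, hn'⟩ := (h.and_eventually h').exists
    exact hn' _ hn rfl

/-! ### Traces of finite sets of infinite sequences. -/

namespace NBA

open PrefixSet

variable {Q A : Type*} {k : ℕ}

/-- The prefix `ρ₀ ⋯ ρₙ`, as a nonempty word. -/
def prefixWord (n : ℕ) (ρ : ℕ → Q) : List Q × Q := ((List.range n).map ρ, ρ n)

theorem prefixWord_succ_fst (n : ℕ) (ρ : ℕ → Q) :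
    (prefixWord (n + 1) ρ).1 = (prefixWord n ρ).1 ++ [(prefixWord n ρ).2] := by
  simp [prefixWord, List.range_succ]

theorem prefixWord_eq_iff {n : ℕ} {ρ σ : ℕ → Q} :
    prefixWord n ρ = prefixWord n σ ↔ ∀ i ≤ n, ρ i = σ i := by
  simp only [prefixWord, Prod.mk.injEq, List.map_inj_left, List.mem_range]
  constructor
  · rintro ⟨h₁, h₂⟩ i hi
    rcases hi.lt_or_eq with h | rfl
    exacts [h₁ i h, h₂]
  · exact fun h => ⟨fun i hi => h i hi.le, h n le_rfl⟩

theorem exists_injOn_prefixWord {R : Set (ℕ → Q)} (hR : R.Finite) :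
    ∃ N, ∀ n ≥ N, Set.InjOn (prefixWord n) R := by
  have h : ∀ᶠ n in atTop, ∀ ρ ∈ R, ∀ σ ∈ R, prefixWord n ρ = prefixWord n σ → ρ = σ := by
    rw [eventually_all_finite hR]
    intro ρ _
    rw [eventually_all_finite hR]
    intro σ _
    by_cases hne : ρ = σ
    · simp [hne]
    · obtain ⟨i, hi⟩ := Function.ne_iff.1 hne
      filter_upwards [eventually_ge_atTop i] with n hn h
      exact absurd (prefixWord_eq_iff.1 h i hn) hi
  obtain ⟨N, hN⟩ := eventually_atTop.1 h
  exact ⟨N, fun n hn ρ hρ σ hσ => hN n hn ρ hρ σ hσ⟩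

/-- The nonempty sets of at most `k` infinite sequences. -/
abbrev SeqSet (Q : Type*) (k : ℕ) := {R : Finset (ℕ → Q) // R.Nonempty ∧ R.card ≤ k}

open Classical in
/-- The bit that the prefix of `ρ ∈ R` of length `n + 1` carries. -/
noncomputable def traceBit (𝒜 : NBA Q A) (R : SeqSet Q k) : ℕ → (ℕ → Q) → Bool
  | 0, _ => false
  | n + 1, ρ => decide ((ρ n ∈ 𝒜.final ∨ traceBit 𝒜 R n ρ = true) ∧
      ¬ ∀ σ ∈ R.1, traceBit 𝒜 R n σ = true)

open Classical in
/-- The set of prefixes of length `n + 1` of the elements of `R`, with their bits. -/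
noncomputable def trace (𝒜 : NBA Q A) (R : SeqSet Q k) (n : ℕ) : PrefixSet Q k :=
  ⟨R.1.image fun ρ => (prefixWord n ρ, 𝒜.traceBit R n ρ), R.2.1.image _,
    Finset.card_image_le.trans R.2.2⟩

/-- The sequence of count vectors of the traces of `R`. -/
noncomputable def traceCount (𝒜 : NBA Q A) (R : SeqSet Q k) (n : ℕ) : CountVec Q k :=
  (𝒜.trace R n).toCount

variable {𝒜 : NBA Q A} {w : ℕ → A} {R : SeqSet Q k} {n : ℕ} {P : PrefixSet Q k}

theorem mem_trace {x : (List Q × Q) × Bool} :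
    x ∈ (𝒜.trace R n).carrier ↔ ∃ ρ ∈ R.1, (prefixWord n ρ, 𝒜.traceBit R n ρ) = x := by
  classical
  simp [trace]

theorem words_trace : (𝒜.trace R n).words = prefixWord n '' R.1 := by
  ext u
  simp only [words, mem_trace, Set.mem_ofPred_eq, Set.mem_image, Finset.mem_coe]
  constructor
  · rintro ⟨_, ⟨ρ, hρ, rfl⟩, rfl⟩
    exact ⟨ρ, hρ, rfl⟩
  · rintro ⟨ρ, hρ, rfl⟩
    exact ⟨_, ⟨ρ, hρ, rfl⟩, rfl⟩

theorem traceBit_succ {ρ : ℕ → Q} : 𝒜.traceBit R (n + 1) ρ =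
    𝒜.nextBit (𝒜.trace R n) (ρ n) (𝒜.traceBit R n ρ) := by
  have : (∀ x ∈ (𝒜.trace R n).carrier, x.2 = true) ↔ ∀ σ ∈ R.1, 𝒜.traceBit R n σ = true := by
    constructor
    · exact fun h σ hσ => h _ (mem_trace.2 ⟨σ, hσ, rfl⟩)
    · intro h x hx
      obtain ⟨σ, hσ, rfl⟩ := mem_trace.1 hx
      exact h σ hσ
  rw [traceBit, nextBit, decide_eq_decide, this]

theorem traceBit_succ_eq_true_iff {ρ : ℕ → Q} : 𝒜.traceBit R (n + 1) ρ = true ↔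
    (ρ n ∈ 𝒜.final ∨ 𝒜.traceBit R n ρ = true) ∧ ¬ ∀ σ ∈ R.1, 𝒜.traceBit R n σ = true := by
  classical
  rw [traceBit]
  exact decide_eq_true_iff

theorem isInitSet_trace (h : ∀ ρ ∈ R.1, ρ 0 ∈ 𝒜.init) : 𝒜.IsInitSet (𝒜.trace R 0) := by
  intro x hx
  obtain ⟨ρ, hρ, rfl⟩ := mem_trace.1 hx
  exact ⟨rfl, h ρ hρ, rfl⟩

theorem extends_trace {ρ : ℕ → Q} {a : A} (h : ρ (n + 1) ∈ 𝒜.δ (ρ n) a) :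
    𝒜.Extends a (𝒜.trace R n) (prefixWord n ρ, 𝒜.traceBit R n ρ)
      (prefixWord (n + 1) ρ, 𝒜.traceBit R (n + 1) ρ) :=
  extends_iff.2 ⟨prefixWord_succ_fst n ρ, h, traceBit_succ⟩

theorem isSucc_trace {a : A} (h : ∀ ρ ∈ R.1, ρ (n + 1) ∈ 𝒜.δ (ρ n) a) :
    𝒜.IsSucc a (𝒜.trace R n) (𝒜.trace R (n + 1)) := by
  constructor
  · intro x hx
    obtain ⟨ρ, hρ, rfl⟩ := mem_trace.1 hx
    exact ⟨_, mem_trace.2 ⟨ρ, hρ, rfl⟩, extends_trace (h ρ hρ)⟩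
  · intro x hx
    obtain ⟨ρ, hρ, rfl⟩ := mem_trace.1 hx
    exact ⟨_, mem_trace.2 ⟨ρ, hρ, rfl⟩, extends_trace (h ρ hρ)⟩

theorem trace_mem_reachSets (h : ∀ ρ ∈ R.1, 𝒜.IsPath w ρ) :
    ∀ n, 𝒜.trace R n ∈ 𝒜.reachSets w (𝒜.traceCount R) n
  | 0 => ⟨isInitSet_trace fun ρ hρ => (h ρ hρ).1, rfl⟩
  | n + 1 => ⟨_, trace_mem_reachSets h n, isSucc_trace fun ρ hρ => (h ρ hρ).2 n, rfl⟩

theorem traceCount_final_iff [Fintype Q] : 𝒜.traceCount R n ∈ (𝒜.preKdis k).final ↔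
    ∀ ρ ∈ R.1, 𝒜.traceBit R n ρ = true := by
  rw [traceCount, toCount_final_iff]
  constructor
  · exact fun h σ hσ => h _ (mem_trace.2 ⟨σ, hσ, rfl⟩)
  · intro h x hx
    obtain ⟨σ, hσ, rfl⟩ := mem_trace.1 hx
    exact h σ hσ

/-- When all bits are true, the next step resets them, and a bit recovers only after its path visits
a final state. Without resets from some time on, visited bits would stay true, so all would
eventually be true together. -/
theorem frequently_traceBit_iff :
    (∃ᶠ n in atTop, ∀ ρ ∈ R.1, 𝒜.traceBit R n ρ = true) ↔
      ∀ ρ ∈ R.1, ∃ᶠ n in atTop, ρ n ∈ 𝒜.final := by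
  constructor
  · intro h ρ hρ
    rw [frequently_atTop] at h ⊢
    intro N
    obtain ⟨i, hi, hall⟩ := h N
    obtain ⟨j, hj, hall'⟩ := h (i + 1)
    by_contra! hn
    have : ∀ m ≥ i + 1, 𝒜.traceBit R m ρ = false := by
      intro m hm
      induction m, hm using Nat.le_induction with
      | base =>
        rw [← Bool.not_eq_true, traceBit_succ_eq_true_iff]
        exact fun h => h.2 hall
      | succ m hm ih =>
        rw [← Bool.not_eq_true, traceBit_succ_eq_true_iff]
        rintro ⟨h | h, -⟩
        · exact hn m (by omega) h
        · simp [ih] at h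
    simpa [this j hj] using hall' ρ hρ
  · intro h
    by_contra hn
    rw [not_frequently] at hn
    obtain ⟨N, hN⟩ := eventually_atTop.1 hn
    have hev : ∀ᶠ n in atTop, ∀ ρ ∈ R.1, 𝒜.traceBit R n ρ = true := by
      rw [eventually_all_finset]
      intro ρ hρ
      obtain ⟨i, hi, hρi⟩ := frequently_atTop.1 (h ρ hρ) N
      filter_upwards [eventually_ge_atTop (i + 1)] with m hm
      induction m, hm using Nat.le_induction with
      | base => exact traceBit_succ_eq_true_iff.2 ⟨Or.inl hρi, hN i hi⟩
      | succ m hm ih => exact traceBit_succ_eq_true_iff.2 ⟨Or.inr ih, hN m (by omega)⟩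
    obtain ⟨n, hn, hn'⟩ := (hn.and hev).exists
    exact hn hn'

theorem traceCount_buchiAccepting_iff [Fintype Q] :
    BuchiAccepting (𝒜.preKdis k).final (𝒜.traceCount R) ↔
      ∀ ρ ∈ R.1, BuchiAccepting 𝒜.final ρ := by
  simp only [buchiAccepting_iff_frequently, traceCount_final_iff, frequently_traceBit_iff]

theorem traceCount_mem_finalPaths [Fintype Q] (h : (R.1 : Set (ℕ → Q)) ⊆ 𝒜.finalPaths w) :
    𝒜.traceCount R ∈ (𝒜.preKdis k).finalPaths w := by
  have hp : ∀ ρ ∈ R.1, 𝒜.IsPath w ρ := fun ρ hρ => (h hρ).1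
  refine ⟨⟨(isInitSet_trace fun ρ hρ => (hp ρ hρ).1).preKdis_init_ne_zero, fun n => ?_⟩,
    traceCount_buchiAccepting_iff.2 fun ρ hρ => (h hρ).2⟩
  exact preKdis_M_ne_zero_iff.2 ((isSucc_trace fun ρ hρ => (hp ρ hρ).2 n).succNum_ne_zero
    (proper_of_mem_reachSets (trace_mem_reachSets hp n)))

/-! ### Infinite chains of successors are traces. -/

section Chain

variable {s : ℕ → PrefixSet Q k} (h₀ : 𝒜.IsInitSet (s 0))
  (hs : ∀ i, 𝒜.IsSucc (w i) (s i) (s (i + 1)))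

include hs in
theorem step_of_prefixWord_mem_words {ρ : ℕ → Q} (h : prefixWord (n + 1) ρ ∈ (s (n + 1)).words) :
    prefixWord n ρ ∈ (s n).words ∧ ρ (n + 1) ∈ 𝒜.δ (ρ n) (w n) := by
  obtain ⟨y, hy, hyρ⟩ := h
  obtain ⟨x, hx, hxy⟩ := (hs n).2 y hy
  rw [extends_iff, hyρ, prefixWord_succ_fst] at hxy
  -- The bit `true` is a dummy, as `word` ignores it.
  have hxρ : prefixWord n ρ = x.1 := (word_eq_iff (x := (prefixWord n ρ, true))).1 hxy.1
  refine ⟨⟨x, hx, hxρ.symm⟩, ?_⟩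
  have := hxy.2.1
  rwa [← hxρ] at this

include h₀ hs in
theorem length_word_of_mem : ∀ n, ∀ x ∈ (s n).carrier, (word x).length = n + 1
  | 0, x, hx => by simp [word, (h₀ x hx).1]
  | n + 1, y, hy => by
    obtain ⟨x, hx, hxy⟩ := (hs n).2 y hy
    rw [extends_iff] at hxy
    rw [word, hxy.1, List.length_append, length_word_of_mem n x hx, List.length_singleton]

-- Choosing extensions of `x` forever gives words that are prefixes of one another; `ρ` is their
-- limit. Shorter prefixes are in the chain because parents are.
include h₀ hs in
theorem exists_seq_of_mem {x : (List Q × Q) × Bool} (hx : x ∈ (s n).carrier) :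
    ∃ ρ : ℕ → Q, (∀ m, prefixWord m ρ ∈ (s m).words) ∧ prefixWord n ρ = x.1 := by
  have hex : ∀ j, ∀ x ∈ (s j).carrier, ∃ y ∈ (s (j + 1)).carrier, word x <+: word y := by
    intro j x hx
    obtain ⟨y, hy, hxy⟩ := (hs j).1 x hx
    refine ⟨y, hy, ?_⟩
    rw [extends_iff] at hxy
    rw [← hxy.1]
    exact List.prefix_append _ _
  choose! f hf hpre using hex
  let y : ℕ → (List Q × Q) × Bool := fun j => Nat.rec x (fun j z => f (n + j) z) j
  have hy : ∀ j, y j ∈ (s (n + j)).carrier := by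
    intro j
    induction j with
    | zero => exact hx
    | succ j ih => exact hf (n + j) _ ih
  have hlen : ∀ j, (word (y j)).length = n + j + 1 := fun j => length_word_of_mem h₀ hs _ _ (hy j)
  have hmono : ∀ i j, i ≤ j → word (y i) <+: word (y j) := by
    intro i j hij
    induction j, hij using Nat.le_induction with
    | base => exact List.prefix_rfl
    | succ j hij ih => exact ih.trans (hpre (n + j) _ (hy j))
  let ρ : ℕ → Q := fun i => (word (y i))[i]'(by rw [hlen]; omega)
  have hρ : ∀ i j, (hi : i < n + j + 1) → ρ i = (word (y j))[i]'(by rw [hlen]; exact hi) := by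
    intro i j hi
    rcases le_total i j with hij | hij
    · exact (hmono i j hij).getElem _
    · exact ((hmono j i hij).getElem _).symm
  have hword : ∀ j, prefixWord (n + j) ρ = (y j).1 := by
    intro j
    refine (word_eq_iff (x := (prefixWord (n + j) ρ, true))).1 ?_
    apply List.ext_getElem
    · simp [word, prefixWord, ← hlen j]
    · intro i hi hi'
      rw [hlen] at hi'
      rw [← hρ i j hi']
      simp [word, prefixWord, List.getElem_append]
      intro h
      congr
      omega
  have hdown : ∀ m j, prefixWord (m + j) ρ ∈ (s (m + j)).words →
      prefixWord m ρ ∈ (s m).words := by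
    intro m j
    induction j with
    | zero => exact id
    | succ j ih => exact fun h => ih (step_of_prefixWord_mem_words hs h).1
  -- `hword` covers only prefixes at index `n` or later, so index `m` is reached by descending from
  -- `m + n`.
  refine ⟨ρ, fun m => hdown m n ?_, hword 0⟩
  rw [add_comm, hword]
  exact ⟨_, hy m, rfl⟩

-- `R` consists of all sequences whose prefixes all lie in the chain. At a level that separates
-- finitely many of them they have distinct words, so there are at most `k`. Equality of words then
-- lifts to bits by induction.
include h₀ hs in
theorem exists_eq_trace :
    ∃ R : SeqSet Q k, (∀ ρ ∈ R.1, 𝒜.IsPath w ρ) ∧ ∀ n, s n = 𝒜.trace R n := by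
  classical
  let S : Set (ℕ → Q) := {ρ | ∀ n, prefixWord n ρ ∈ (s n).words}
  have hcard : ∀ R : Finset (ℕ → Q), (R : Set (ℕ → Q)) ⊆ S → R.card ≤ k := by
    intro R hR
    obtain ⟨N, hN⟩ := exists_injOn_prefixWord R.finite_toSet
    refine le_trans ?_ (s N).card_le
    rw [← Finset.card_image_of_injOn (hN N le_rfl)]
    refine (Finset.card_le_card (t := (s N).carrier.image Prod.fst) ?_).trans
      Finset.card_image_le
    intro u hu
    obtain ⟨ρ, hρ, rfl⟩ := Finset.mem_image.1 hu
    exact Finset.mem_image.2 (hR hρ N)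
  have hfin : S.Finite := by
    by_contra hinf
    obtain ⟨R, hR, hc⟩ := Set.Infinite.exists_subset_card_eq hinf (k + 1)
    have := hcard R hR
    omega
  have hne : hfin.toFinset.Nonempty := by
    obtain ⟨x, hx⟩ := (s 0).nonempty
    obtain ⟨ρ, hρ, -⟩ := exists_seq_of_mem h₀ hs hx
    exact ⟨ρ, hfin.mem_toFinset.2 hρ⟩
  let R : SeqSet Q k := ⟨hfin.toFinset, hne, hcard _ (by simp)⟩
  have hpath : ∀ ρ ∈ R.1, 𝒜.IsPath w ρ := by
    intro ρ hρ
    have hρ : ρ ∈ S := hfin.mem_toFinset.1 hρ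
    obtain ⟨x, hx, hxρ⟩ := hρ 0
    refine ⟨?_, fun i => (step_of_prefixWord_mem_words hs (hρ (i + 1))).2⟩
    have := (h₀ x hx).2.1
    rwa [hxρ] at this
  have hwords : ∀ n, (s n).words = (𝒜.trace R n).words := by
    intro n
    rw [words_trace]
    ext u
    constructor
    · rintro ⟨x, hx, rfl⟩
      obtain ⟨ρ, hρ, h⟩ := exists_seq_of_mem h₀ hs hx
      exact ⟨ρ, hfin.mem_toFinset.2 hρ, h⟩
    · rintro ⟨ρ, hρ, rfl⟩
      exact hfin.mem_toFinset.1 hρ n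
  refine ⟨R, hpath, fun n => ?_⟩
  have hmem : ∀ n, s n ∈ 𝒜.reachSets w (fun i => (s i).toCount) n := by
    intro n
    induction n with
    | zero => exact ⟨h₀, rfl⟩
    | succ n ih => exact ⟨_, ih, hs n, rfl⟩
  induction n with
  | zero =>
    have h₁ : 𝒜.IsInitSet (𝒜.trace R 0) := isInitSet_trace fun ρ hρ => (hpath ρ hρ).1
    exact carrier_injective ((h₀.carrier_subset h₁ (hwords 0).subset).antisymm
      (h₁.carrier_subset h₀ (hwords 0).superset))
  | succ n ih =>
    have hp := proper_of_mem_reachSets (hmem n)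
    have h₁ : 𝒜.IsSucc (w n) (s n) (𝒜.trace R (n + 1)) := by
      rw [ih]
      exact isSucc_trace fun ρ hρ => (hpath ρ hρ).2 n
    exact carrier_injective (((hs n).carrier_subset hp h₁ (hwords _).subset).antisymm
      (h₁.carrier_subset hp (hs n) (hwords _).superset))

end Chain

theorem exists_chain_of_mem_reachSets {r : ℕ → CountVec Q k} (hP : P ∈ 𝒜.reachSets w r n) :
    ∃ s : ℕ → PrefixSet Q k, 𝒜.IsInitSet (s 0) ∧ (s 0).toCount = r 0 ∧ s n = P ∧
      ∀ i < n, 𝒜.IsSucc (w i) (s i) (s (i + 1)) ∧ (s (i + 1)).toCount = r (i + 1) := by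
  induction n generalizing P with
  | zero => exact ⟨fun _ => P, hP.1, hP.2, rfl, by simp⟩
  | succ n ih =>
    obtain ⟨P₁, hP₁, hs, hc⟩ := hP
    obtain ⟨s, h₀, h₀', hn, h⟩ := ih hP₁
    -- Beyond index `n` the value `P` is filler for the indices without constraints.
    refine ⟨fun i => if i ≤ n then s i else P, by simpa using h₀, by simpa using h₀', by simp,
      fun i hi => ?_⟩
    rcases (Nat.lt_succ_iff.1 hi).lt_or_eq with hlt | rfl
    · simpa [hlt.le, Nat.succ_le_of_lt hlt] using h i hlt
    · simpa [hn] using ⟨hs, hc⟩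

/-- Nonzero edge weights let every reached set be continued along `r` forever, so no reached set is
a dead end; the resulting chain is a trace, and acceptance of `r` makes its paths final. -/
theorem exists_trace_of_mem_reachSets [Fintype Q] {r : ℕ → CountVec Q k}
    (hr : r ∈ (𝒜.preKdis k).finalPaths w) (hP : P ∈ 𝒜.reachSets w r n) :
    ∃ R : SeqSet Q k, (R.1 : Set (ℕ → Q)) ⊆ 𝒜.finalPaths w ∧ 𝒜.traceCount R = r ∧
      𝒜.trace R n = P := by
  obtain ⟨s, h₀, h₀', hn, h⟩ := exists_chain_of_mem_reachSets hP
  have hex : ∀ i P, P ∈ 𝒜.reachSets w r i →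
      ∃ P', 𝒜.IsSucc (w i) P P' ∧ P'.toCount = r (i + 1) := by
    intro i P hP
    have := preKdis_M_ne_zero_iff.1 (hr.1.2 i)
    rw [← toCount_of_mem_reachSets hP] at this
    obtain ⟨P', hs, hc⟩ := exists_isSucc_of_succNum_ne_zero (proper_of_mem_reachSets hP) this
    exact ⟨P', hs, Subtype.ext hc⟩
  choose! f hf hf' using hex
  -- Follow the history of `P` up to `n`, then chosen successors.
  let t : ℕ → PrefixSet Q k := fun i => Nat.rec (s 0)
    (fun i P => if i < n then s (i + 1) else f i P) i
  have ht : ∀ i, t (i + 1) = if i < n then s (i + 1) else f i (t i) := fun i => rfl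
  have hts : ∀ i ≤ n, t i = s i := by
    intro i hi
    cases i with
    | zero => rfl
    | succ i => rw [ht, if_pos (Nat.lt_of_succ_le hi)]
  have hstep : ∀ i, t i ∈ 𝒜.reachSets w r i →
      𝒜.IsSucc (w i) (t i) (t (i + 1)) ∧ (t (i + 1)).toCount = r (i + 1) := by
    intro i hi
    by_cases hin : i < n
    · rw [hts i hin.le, hts (i + 1) hin]
      exact h i hin
    · rw [ht, if_neg hin]
      exact ⟨hf i _ hi, hf' i _ hi⟩
  have hmem : ∀ i, t i ∈ 𝒜.reachSets w r i := by
    intro i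
    induction i with
    | zero => exact ⟨h₀, h₀'⟩
    | succ i ih => exact ⟨t i, ih, hstep i ih⟩
  obtain ⟨R, hR, htr⟩ := exists_eq_trace (s := t) h₀ fun i => (hstep i (hmem i)).1
  have hcount : 𝒜.traceCount R = r := by
    funext i
    rw [traceCount, ← htr, toCount_of_mem_reachSets (hmem i)]
  refine ⟨R, fun ρ hρ => ⟨hR ρ hρ, ?_⟩, hcount, by rw [← htr, hts n le_rfl, hn]⟩
  exact traceCount_buchiAccepting_iff.1 (hcount ▸ hr.2) ρ hρ

end NBA

/-! ### Unrolling a loop into an infinite path. -/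

theorem exists_seq_of_transGen {α : Type*} {r : α → α → Prop} {x y : α}
    (h : Relation.TransGen r x y) :
    ∃ (n : ℕ) (p : ℕ → α), 0 < n ∧ p 0 = x ∧ p n = y ∧ ∀ i < n, r (p i) (p (i + 1)) := by
  induction h using Relation.TransGen.head_induction_on with
  | @single z h =>
    refine ⟨1, fun i => Nat.casesOn i z fun _ => y, one_pos, rfl, rfl, fun i hi => ?_⟩
    obtain rfl : i = 0 := by omega
    exact h
  | @head z _ h _ ih =>
    obtain ⟨n, p, hn, h₀, h₁, hp⟩ := ih
    refine ⟨n + 1, fun i => Nat.casesOn i z p, n.succ_pos, rfl, h₁, fun i hi => ?_⟩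
    cases i with
    | zero => exact (congrArg _ h₀).mpr h
    | succ i => exact hp i (by omega)

theorem exists_loop_of_transGen {α : Type*} {r : α → α → Prop} {x : α}
    (h : Relation.TransGen r x x) :
    ∃ ρ : ℕ → α, ρ 0 = x ∧ (∀ i, r (ρ i) (ρ (i + 1))) ∧ ∃ᶠ n in atTop, ρ n = x := by
  obtain ⟨n, p, hn, h₀, h₁, hp⟩ := exists_seq_of_transGen h
  refine ⟨fun i => p (i % n), by simpa using h₀, fun i => ?_, frequently_atTop.2 fun a => ?_⟩
  · have hi := hp (i % n) (Nat.mod_lt i hn)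
    rcases (Nat.succ_le_of_lt (Nat.mod_lt i hn)).lt_or_eq with hlt | heq
    · have : (i + 1) % n = i % n + 1 := by
        rw [Nat.add_mod, Nat.mod_eq_of_lt (by omega : 1 < n), Nat.mod_eq_of_lt hlt]
      simpa only [this] using hi
    · have : (i + 1) % n = 0 := by
        rw [← Nat.mod_add_mod, ← Nat.succ_eq_add_one, heq, Nat.mod_self]
      simp only [this, h₀]
      rwa [← Nat.succ_eq_add_one, heq, h₁] at hi
  · exact ⟨a * n, Nat.le_mul_of_pos_right a hn, by simpa using h₀⟩

/-! ### Trimming preserves final paths and weights. -/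

namespace WeightedBuchi

variable {Q A : Type*} {ℬ : WeightedBuchi Q A} {w : ℕ → A} {ρ : ℕ → Q} {v v' : ℚ}

theorem HasWordWeight.unique (h : ℬ.HasWordWeight w v) (h' : ℬ.HasWordWeight w v') :
    v = v' := by
  obtain ⟨hf, c, hc, rfl⟩ := h
  obtain ⟨_, c', hc', rfl⟩ := h'
  refine Finset.sum_congr rfl fun ρ hρ => ?_
  rw [Set.Finite.mem_toFinset] at hρ
  exact tendsto_nhds_unique (hc ρ hρ) (hc' ρ hρ)

theorem IsPath.reflTransGen (h : ℬ.IsPath w ρ) {m n : ℕ} (hmn : m ≤ n) :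
    Relation.ReflTransGen ℬ.Edge (ρ m) (ρ n) := by
  induction n, hmn using Nat.le_induction with
  | base => exact .refl
  | succ n _ ih => exact ih.tail ⟨_, h.2 n⟩

/-- Two later visits to the recurring final state close the required loop. -/
theorem isTrimState_of_mem_finalPaths (h : ρ ∈ ℬ.finalPaths w) (n : ℕ) :
    ℬ.IsTrimState (ρ n) := by
  obtain ⟨f, hf, hfreq⟩ := h.2
  rw [frequently_atTop] at hfreq
  obtain ⟨i, hi, hρi⟩ := hfreq n
  obtain ⟨j, hj, hρj⟩ := hfreq (i + 1)
  refine ⟨⟨ρ 0, h.1.1, h.1.reflTransGen n.zero_le⟩, f, hf, hρi ▸ h.1.reflTransGen hi, ?_⟩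
  have := Relation.TransGen.head' ⟨_, h.1.2 i⟩ (h.1.reflTransGen hj)
  rwa [hρi, hρj] at this

theorem comp_val_mem_finalPaths_iff {ρ : ℕ → {q // ℬ.IsTrimState q}} :
    (Subtype.val ∘ ρ) ∈ ℬ.finalPaths w ↔ ρ ∈ ℬ.trim.finalPaths w := by
  refine and_congr Iff.rfl ⟨?_, ?_⟩
  · rintro ⟨q, hq, h⟩
    obtain ⟨n, hn⟩ := h.exists
    refine ⟨ρ n, ?_, h.mono fun m hm => Subtype.ext (hm.trans hn.symm)⟩
    exact (congrArg (· ∈ ℬ.final) hn).mpr hq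
  · rintro ⟨q, hq, h⟩
    exact ⟨q.1, hq, h.mono fun m hm => congrArg Subtype.val hm⟩

theorem comp_val_injective :
    Function.Injective fun ρ : ℕ → {q // ℬ.IsTrimState q} => Subtype.val ∘ ρ :=
  fun _ _ h => funext fun n => Subtype.ext (congrFun h n)

theorem image_finalPaths_trim :
    (fun ρ : ℕ → {q // ℬ.IsTrimState q} => Subtype.val ∘ ρ) '' ℬ.trim.finalPaths w =
      ℬ.finalPaths w := by
  ext ρ
  constructor
  · rintro ⟨ρ, hρ, rfl⟩
    exact comp_val_mem_finalPaths_iff.2 hρ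
  · intro hρ
    exact ⟨fun n => ⟨ρ n, isTrimState_of_mem_finalPaths hρ n⟩,
      comp_val_mem_finalPaths_iff.1 hρ, rfl⟩

theorem encard_finalPaths_trim : (ℬ.trim.finalPaths w).encard = (ℬ.finalPaths w).encard := by
  exact (comp_val_injective.encard_image _).symm.trans (congrArg _ image_finalPaths_trim)

theorem HasWordWeight.trim (h : ℬ.HasWordWeight w v) : ℬ.trim.HasWordWeight w v := by
  classical
  obtain ⟨hf, c, hc, rfl⟩ := h
  have hf' : (ℬ.trim.finalPaths w).Finite :=
    Set.Finite.of_finite_image (image_finalPaths_trim.symm ▸ hf)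
      comp_val_injective.injOn
  refine ⟨hf', fun ρ => c (Subtype.val ∘ ρ),
    fun ρ hρ => hc _ (comp_val_mem_finalPaths_iff.2 hρ), ?_⟩
  have : hf.toFinset = hf'.toFinset.image
      fun ρ : ℕ → {q // ℬ.IsTrimState q} => Subtype.val ∘ ρ := by
    rw [← Finset.coe_inj]
    simp [image_finalPaths_trim]
  rw [this, Finset.sum_image comp_val_injective.injOn]

end WeightedBuchi

/-! ### Sets of final paths and the reached prefix sets. -/

namespace NBA

open PrefixSet

variable {Q A : Type*} {k : ℕ} {𝒜 : NBA Q A} {w : ℕ → A}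

/-- The nonempty sets of at most `k` final paths over `w`. -/
def finalSeqSets (𝒜 : NBA Q A) (k : ℕ) (w : ℕ → A) : Set (SeqSet Q k) :=
  {R | (R.1 : Set (ℕ → Q)) ⊆ 𝒜.finalPaths w}

theorem IsAmbiguous.finite_finalPaths (h : 𝒜.IsAmbiguous k) (w : ℕ → A) :
    (𝒜.finalPaths w).Finite := Set.finite_of_encard_le_coe (h w)

theorem IsAmbiguous.card_finalPaths_le (h : 𝒜.IsAmbiguous k) (w : ℕ → A) :
    (h.finite_finalPaths w).toFinset.card ≤ k := by
  have := h w
  rwa [(h.finite_finalPaths w).encard_eq_coe_toFinset_card, Nat.cast_le] at this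

theorem image_finalSeqSets (h : 𝒜.IsAmbiguous k) (w : ℕ → A) [DecidableEq (ℕ → Q)] :
    Subtype.val '' 𝒜.finalSeqSets k w =
      ((h.finite_finalPaths w).toFinset.powerset.erase ∅ : Finset (Finset (ℕ → Q))) := by
  ext R
  have hsub : R ⊆ (h.finite_finalPaths w).toFinset ↔ (R : Set (ℕ → Q)) ⊆ 𝒜.finalPaths w := by
    simp
  rw [Finset.mem_coe, Finset.mem_erase, Finset.mem_powerset, ← Finset.nonempty_iff_ne_empty, hsub]
  constructor
  · rintro ⟨R, hR, rfl⟩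
    exact ⟨R.2.1, hR⟩
  · rintro ⟨hne, hR⟩
    exact ⟨⟨R, hne, (Finset.card_le_card (hsub.2 hR)).trans (h.card_finalPaths_le w)⟩, hR, rfl⟩

theorem finite_finalSeqSets (h : 𝒜.IsAmbiguous k) (w : ℕ → A) :
    (𝒜.finalSeqSets k w).Finite := by
  classical
  refine Set.Finite.of_finite_image ?_ Subtype.val_injective.injOn
  rw [image_finalSeqSets h]
  exact Finset.finite_toSet _

theorem ncard_finalSeqSets_le (h : 𝒜.IsAmbiguous k) (w : ℕ → A) :
    (𝒜.finalSeqSets k w).ncard ≤ 2 ^ k := by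
  classical
  rw [← Set.ncard_image_of_injective _ Subtype.val_injective, image_finalSeqSets h,
    Set.ncard_coe_finset]
  refine (Finset.card_le_card (Finset.erase_subset _ _)).trans ?_
  rw [Finset.card_powerset]
  exact Nat.pow_le_pow_right two_pos (h.card_finalPaths_le w)

section Count

variable [Fintype Q] {r : ℕ → CountVec Q k}

/-- The first edge witnesses this: `succNum` is `0` at vectors that no proper set realizes. -/
theorem exists_countVec_eq_of_isPath (hr : (𝒜.preKdis k).IsPath w r) :
    ∃ P : PrefixSet Q k, P.countVec = (r 0).1 :=
  (exists_proper_of_succNum_ne_zero (preKdis_M_ne_zero_iff.1 (hr.2 0))).imp fun _ h => h.2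

theorem reachSets_eq_image (hr : r ∈ (𝒜.preKdis k).finalPaths w) (n : ℕ) :
    𝒜.reachSets w r n =
      (fun R => 𝒜.trace R n) '' {R ∈ 𝒜.finalSeqSets k w | 𝒜.traceCount R = r} := by
  ext P
  constructor
  · intro hP
    obtain ⟨R, hR, hc, hP⟩ := exists_trace_of_mem_reachSets hr hP
    exact ⟨R, ⟨hR, hc⟩, hP⟩
  · rintro ⟨R, ⟨hR, rfl⟩, rfl⟩
    exact trace_mem_reachSets (fun ρ hρ => (hR hρ).1) n

theorem ncard_reachSets_le (h : 𝒜.IsAmbiguous k) (hr : r ∈ (𝒜.preKdis k).finalPaths w) (n : ℕ) :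
    (𝒜.reachSets w r n).ncard ≤ 2 ^ k := by
  have hfin := finite_finalSeqSets h w
  rw [reachSets_eq_image hr]
  exact (Set.ncard_image_le (hfin.subset fun _ h => h.1)).trans
    ((Set.ncard_le_ncard (fun _ h => h.1) hfin).trans (ncard_finalSeqSets_le h w))

theorem ncard_reachSets (hr : (𝒜.preKdis k).IsPath w r) (n : ℕ) :
    (𝒜.reachSets w r n).ncard =
      ∏ i ∈ Finset.range n, 𝒜.succNum (r i).1 (w i) (r (i + 1)).1 := by
  obtain ⟨P, hP⟩ := exists_countVec_eq_of_isPath hr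
  induction n with
  | zero =>
    obtain ⟨P₀, h⟩ := exists_setOf_isInitSet_eq_singleton hr.1 hP
    rw [reachSets, h]
    simp
  | succ n ih =>
    rw [ncard_reachSets_succ (finite_reachSets hr.1 hP n), ih, Finset.prod_range_succ]

theorem finalPaths_preKdis_subset :
    (𝒜.preKdis k).finalPaths w ⊆ 𝒜.traceCount '' 𝒜.finalSeqSets k w := by
  intro r hr
  obtain ⟨P, hP⟩ := exists_countVec_eq_of_isPath hr.1
  obtain ⟨P₀, h⟩ := exists_setOf_isInitSet_eq_singleton hr.1.1 hP
  have hP₀ : P₀ ∈ 𝒜.reachSets w r 0 := h.symm.subset rfl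
  obtain ⟨R, hR, hc, -⟩ := exists_trace_of_mem_reachSets hr hP₀
  exact ⟨R, hR, hc⟩

theorem finite_finalPaths_preKdis (h : 𝒜.IsAmbiguous k) (w : ℕ → A) :
    ((𝒜.preKdis k).finalPaths w).Finite :=
  ((finite_finalSeqSets h w).image _).subset finalPaths_preKdis_subset

theorem encard_finalPaths_preKdis_le (h : 𝒜.IsAmbiguous k) (w : ℕ → A) :
    ((𝒜.preKdis k).finalPaths w).encard ≤ (2 ^ k : ℕ) := by
  have hfin := finite_finalSeqSets h w
  refine (Set.encard_le_encard finalPaths_preKdis_subset).trans ((Set.encard_image_le _ _).trans ?_)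
  rw [← hfin.cast_ncard_eq, Nat.cast_le]
  exact ncard_finalSeqSets_le h w

/-! ### Loop edges have weight one. -/

/-- There is an accepting run from `r`, with a finite prefix over which the product of the
successor counts is at least `m`. -/
def HasAcceptingRun (𝒜 : NBA Q A) (r : CountVec Q k) (m : ℕ) : Prop :=
  ∃ (w : ℕ → A) (ρ : ℕ → CountVec Q k), ρ 0 = r ∧
    (∀ i, (𝒜.preKdis k).M (w i) (ρ i) (ρ (i + 1)) ≠ 0) ∧
    BuchiAccepting (𝒜.preKdis k).final ρ ∧
    ∃ n, m ≤ ∏ i ∈ Finset.range n, 𝒜.succNum (ρ i).1 (w i) (ρ (i + 1)).1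

theorem HasAcceptingRun.cons {r r' : CountVec Q k} {a : A} {m : ℕ}
    (h : 𝒜.HasAcceptingRun r' m) (ha : (𝒜.preKdis k).M a r r' ≠ 0) :
    𝒜.HasAcceptingRun r (𝒜.succNum r.1 a r'.1 * m) := by
  obtain ⟨w, ρ, rfl, hρ, ⟨q, hq, hfreq⟩, n, hn⟩ := h
  refine ⟨fun i => Nat.casesOn i a w, fun i => Nat.casesOn i r ρ, rfl, ?_, ⟨q, hq, ?_⟩, n + 1, ?_⟩
  · rintro (_ | i)
    exacts [ha, hρ i]
  · rw [frequently_atTop] at hfreq ⊢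
    intro N
    obtain ⟨i, hi, h⟩ := hfreq N
    exact ⟨i + 1, by omega, h⟩
  · rw [Finset.prod_range_succ', mul_comm]
    exact Nat.mul_le_mul_right _ hn

theorem HasAcceptingRun.of_reflTransGen {r r' : CountVec Q k} {m : ℕ}
    (h : 𝒜.HasAcceptingRun r' m) (hr : Relation.ReflTransGen (𝒜.preKdis k).Edge r r') :
    𝒜.HasAcceptingRun r m := by
  induction hr using Relation.ReflTransGen.head_induction_on with
  | refl => exact h
  | head he _ ih =>
    obtain ⟨a, ha⟩ := he
    obtain ⟨w, ρ, h₀, h₁, h₂, n, hn⟩ := ih.cons ha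
    have := Nat.pos_of_ne_zero (preKdis_M_ne_zero_iff.1 ha)
    exact ⟨w, ρ, h₀, h₁, h₂, n, (Nat.le_mul_of_pos_left m this).trans hn⟩

theorem hasAcceptingRun_of_isTrimState {r : CountVec Q k}
    (h : (𝒜.preKdis k).IsTrimState r) : 𝒜.HasAcceptingRun r 1 := by
  obtain ⟨-, f, hf, hrf, hff⟩ := h
  obtain ⟨ρ, h₀, hρ, hfreq⟩ := exists_loop_of_transGen hff
  choose w hw using hρ
  exact HasAcceptingRun.of_reflTransGen ⟨w, ρ, h₀, hw, ⟨f, hf, hfreq⟩, 0, by simp⟩ hrf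

/-- From an initial state the product counts reached prefix sets, which are traces of sets of final
paths. -/
theorem HasAcceptingRun.le (h : 𝒜.IsAmbiguous k) {r : CountVec Q k} {m : ℕ}
    (hr : (𝒜.preKdis k).init r ≠ 0) (hm : 𝒜.HasAcceptingRun r m) : m ≤ 2 ^ k := by
  obtain ⟨w, ρ, rfl, hρ, hacc, n, hn⟩ := hm
  have hp : (𝒜.preKdis k).IsPath w ρ := ⟨hr, hρ⟩
  exact hn.trans ((ncard_reachSets hp n).symm.le.trans (ncard_reachSets_le h ⟨hp, hacc⟩ n))

/-- Each turn through an edge of count at least `2` doubles the product. After `k + 1` turns,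
preceded by a path from an initial state, it exceeds `2 ^ k`. -/
theorem succNum_le_one_of_loop (h : 𝒜.IsAmbiguous k) {r r' : CountVec Q k} {a : A}
    (hr : (𝒜.preKdis k).IsTrimState r)
    (hloop : Relation.ReflTransGen (𝒜.preKdis k).Edge r' r) : 𝒜.succNum r.1 a r'.1 ≤ 1 := by
  by_contra! hlt
  have hM : (𝒜.preKdis k).M a r r' ≠ 0 := preKdis_M_ne_zero_iff.2 (by omega)
  have hpow : ∀ N, 𝒜.HasAcceptingRun r (2 ^ N) := by
    intro N
    induction N with
    | zero => exact hasAcceptingRun_of_isTrimState hr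
    | succ N ih =>
      obtain ⟨w, ρ, h₀, h₁, h₂, n, hn⟩ := (ih.of_reflTransGen hloop).cons hM
      refine ⟨w, ρ, h₀, h₁, h₂, n, le_trans ?_ hn⟩
      rw [pow_succ, mul_comm]
      exact Nat.mul_le_mul_right _ hlt
  obtain ⟨s, hs, hsr⟩ := hr.1
  have := ((hpow (k + 1)).of_reflTransGen hsr).le h hs
  exact absurd this (Nat.pow_lt_pow_right one_lt_two k.lt_succ_self).not_ge

theorem size_le_of_reflTransGen {r r' : CountVec Q k}
    (h : Relation.ReflTransGen (𝒜.preKdis k).Edge r r') :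
    CountVec.size r ≤ CountVec.size r' := by
  induction h with
  | refl => exact le_rfl
  | tail _ he ih =>
    obtain ⟨a, ha⟩ := he
    exact ih.trans (size_le_of_succNum_ne_zero (preKdis_M_ne_zero_iff.1 ha))

theorem ultimatelyStable_kdis (h : 𝒜.IsAmbiguous k) : (𝒜.kdis k).UltimatelyStable := by
  intro q q' a hloop
  have hloop' : Relation.ReflTransGen (𝒜.preKdis k).Edge q'.1 q.1 :=
    hloop.lift Subtype.val fun _ _ h => h
  have hM : (𝒜.kdis k).M a q q' = (-1 : ℚ) ^ ((CountVec.size q'.1 : ℤ) - CountVec.size q.1) *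
    𝒜.succNum q.1.1 a q'.1.1 := rfl
  rw [hM]
  rcases Nat.le_one_iff_eq_zero_or_eq_one.1 (succNum_le_one_of_loop (a := a) h q.2 hloop')
    with h₀ | h₁
  · left
    simp [h₀]
  · right
    have hle := size_le_of_succNum_ne_zero (𝒜 := 𝒜) (a := a) (r := q.1) (r' := q'.1)
      (by simp [h₁])
    rw [hle.antisymm (size_le_of_reflTransGen hloop'), h₁]
    simp

/-! ### Path weights and inclusion-exclusion. -/

open Classical in
/-- The sum of the signs of the sets of final paths whose trace has count vectors `r`. -/
noncomputable def traceWeight (h : 𝒜.IsAmbiguous k) (w : ℕ → A) (r : ℕ → CountVec Q k) : ℚ :=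
  ∑ R ∈ (finite_finalSeqSets h w).toFinset with 𝒜.traceCount R = r, (-1 : ℚ) ^ ((R.1.card : ℤ) - 1)

theorem hasPathWeight_preKdis (h : 𝒜.IsAmbiguous k) {r : ℕ → CountVec Q k}
    (hr : r ∈ (𝒜.preKdis k).finalPaths w) :
    (𝒜.preKdis k).HasPathWeight w r (traceWeight h w r) := by
  classical
  obtain ⟨P, hP⟩ := exists_countVec_eq_of_isPath hr.1
  obtain ⟨N, hN⟩ := exists_injOn_prefixWord (h.finite_finalPaths w)
  refine tendsto_const_nhds.congr' ?_
  filter_upwards [eventually_ge_atTop N] with n hn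
  have hinj : Set.InjOn (fun R : SeqSet Q k => 𝒜.trace R n) (𝒜.finalSeqSets k w) := by
    intro R hR R' hR' heq
    have := congrArg PrefixSet.words heq
    simp only [words_trace] at this
    exact Subtype.ext (Finset.coe_injective (((hN n hn).image_eq_image_iff hR hR').1 this))
  have hset : {R ∈ 𝒜.finalSeqSets k w | 𝒜.traceCount R = r} =
      ({R ∈ (finite_finalSeqSets h w).toFinset | 𝒜.traceCount R = r} : Finset _) := by
    ext R
    simp
  rw [preKdis_prefix_weight hr.1.1 hP, reachSets_eq_image hr,
    (hinj.mono fun _ h => h.1).ncard_image, hset, Set.ncard_coe_finset, traceWeight,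
    mul_comm, ← nsmul_eq_mul]
  -- All these `R` have the same sign: for `n ≥ N` the size of `r n` is the cardinality of each of
  -- them.
  refine Finset.sum_eq_card_nsmul fun R hR => ?_
  have hsub : R ∈ 𝒜.finalSeqSets k w :=
    (Set.Finite.mem_toFinset _).1 (Finset.mem_filter.1 hR).1
  rw [← (Finset.mem_filter.1 hR).2, traceCount, size_toCount, trace, Finset.card_image_of_injOn]
  exact fun ρ hρ σ hσ hρσ => hN n hn (hsub hρ) (hsub hσ) (Prod.mk.inj hρσ).1

theorem hasWordWeight_preKdis (h : 𝒜.IsAmbiguous k) (w : ℕ → A) :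
    (𝒜.preKdis k).HasWordWeight w (∑ R ∈ (finite_finalSeqSets h w).toFinset,
      (-1 : ℚ) ^ ((R.1.card : ℤ) - 1)) := by
  classical
  refine ⟨finite_finalPaths_preKdis h w, traceWeight h w,
    fun r hr => hasPathWeight_preKdis h hr, ?_⟩
  refine (Finset.sum_fiberwise_of_maps_to (fun R hR => ?_) _).symm
  rw [Set.Finite.mem_toFinset] at hR ⊢
  exact traceCount_mem_finalPaths hR

end Count

open Classical in
theorem sum_finalSeqSets_sign (h : 𝒜.IsAmbiguous k) (w : ℕ → A) :
    ∑ R ∈ (finite_finalSeqSets h w).toFinset, (-1 : ℚ) ^ ((R.1.card : ℤ) - 1) =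
      if w ∈ 𝒜.language then 1 else 0 := by
  have himage : (finite_finalSeqSets h w).toFinset.image Subtype.val =
      (h.finite_finalPaths w).toFinset.powerset.erase ∅ := by
    rw [← Finset.coe_inj, Finset.coe_image, Set.Finite.coe_toFinset, image_finalSeqSets h]
  have hsum := Finset.sum_powerset_neg_one_pow_card (x := (h.finite_finalPaths w).toFinset)
  have hsum' : ∑ R ∈ (h.finite_finalPaths w).toFinset.powerset, (-1 : ℚ) ^ R.card =
      if w ∈ 𝒜.language then 0 else 1 := by
    have := congrArg (Int.cast : ℤ → ℚ) hsum
    push_cast at this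
    rw [this]
    simp [language, Set.nonempty_iff_ne_empty]
  rw [← Finset.sum_image (f := fun R : Finset (ℕ → Q) => (-1 : ℚ) ^ ((R.card : ℤ) - 1))
    Subtype.val_injective.injOn, himage]
  -- The alternating sum over all subsets vanishes unless there is no final path; the empty set
  -- contributes `1`, and the shift of the exponent divides by `-1`.
  rw [← Finset.add_sum_erase _ _ (Finset.empty_mem_powerset _), Finset.card_empty, pow_zero,
    add_comm, ← eq_sub_iff_add_eq] at hsum'
  simp only [zpow_sub₀ (by norm_num : (-1 : ℚ) ≠ 0), zpow_natCast, zpow_one, ← Finset.sum_div,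
    hsum']
  split_ifs <;> norm_num

end NBA

open Classical in
theorem NBA.hasWordWeight_kdis {Q A : Type*} [Fintype Q] {k : ℕ} {𝒜 : NBA Q A}
    (h : 𝒜.IsAmbiguous k) (w : ℕ → A) :
    (𝒜.kdis k).HasWordWeight w (if w ∈ 𝒜.language then 1 else 0) := by
  rw [← sum_finalSeqSets_sign h]
  exact (hasWordWeight_preKdis h w).trim

theorem mainTheorem5 {Q A : Type*} [Fintype Q] [Finite A] (k : ℕ) (𝒜 : NBA Q A)
    (h𝒜 : 𝒜.IsAmbiguous k) :
    (∀ (P : PrefixSet Q k) (a : A) (r' : Q × Bool → Fin (k + 1)), P.Proper →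
      𝒜.succCount P a r' = 𝒜.succNum P.countVec a r') ∧
    (𝒜.kdis k).IsImageBinary ∧
    (𝒜.kdis k).language = 𝒜.language := by
  classical
  have hweight := NBA.hasWordWeight_kdis h𝒜
  refine ⟨fun P a r' hP => (NBA.succNum_countVec hP a r').symm,
    ⟨inferInstance, NBA.ultimatelyStable_kdis h𝒜, ⟨2 ^ k, fun w => ?_⟩, fun w => ?_⟩, ?_⟩
  · rw [NBA.kdis, WeightedBuchi.encard_finalPaths_trim]
    exact NBA.encard_finalPaths_preKdis_le h𝒜 w
  · have := hweight w
    split_ifs at this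
    exacts [Or.inr this, Or.inl this]
  · ext w
    refine ⟨fun h => ?_, fun hw => ?_⟩
    · by_contra hw
      have h₀ := hweight w
      rw [if_neg hw] at h₀
      exact one_ne_zero (WeightedBuchi.HasWordWeight.unique h h₀)
    · have h₁ := hweight w
      rwa [if_pos hw] at h₁
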